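/- Words are over the alphabet $\{0,1,2,3\}$ and may be finite or infinite (to the right); a factor of a word is a finite contiguous subword. A word is reduced if none of $02,20,13,31$ is a factor of it, and a Dean word is a reduced word that has no factor $uu$ with $u$ nonempty. For rational $\beta>1$, a word is $\beta^+$-free if every factor $r$ of it with a period $p$, $1\le p\le |r|$, satisfies $|r|/p\le\beta$ (no factor is a repetition of exponent larger than $\beta$). A word is $d$-directed if for every factor $f$ of length $d$ the reverse of $f$ is not a factor. (1) There exists an infinite $\frac53^+$-free $12$-directed Dean word. (2) Let $h$ be the $72$-uniform morphism $$\begin{aligned} 0 &\mapsto 010321012303210301210323010321230321\\ &\phantom{\mapsto{}} 030123210323012103212303210123210323\\ 1 &\mapsto 010321012303210301210323010321230321\\ &\phantom{\mapsto{}} 012321032301210321230321030123210323\\ 2 &\mapsto 010321012303210301210323010321012321\\ &\phantom{\mapsto{}} 032301210321230321012321030121032123\\ 3 &\mapsto 010321012303210301210323010321012321\\ &\phantom{\mapsto{}} 030121032123032101232103230121032123 \end{aligned}$$ For every finite or infinite $\frac75^+$-free word $w$ over $\{0,1,2,3\}$, the image $h(w)$ is a $\frac53^+$-free $12$-directed Dean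 word. (3) Every $5$-directed Dean word $w$ satisfies $|w|<10$; in particular, no infinite Dean word is $5$-directed. -/

import Mathlib

/-- The set of factors (finite contiguous subwords) of a finite word. -/
def finFactors {α : Type*} (w : List α) : Set (List α) := {f | f <:+: w}

/-- The set of (finite) factors of an infinite word `w 0, w 1, w 2, …`. -/
def infFactors {α : Type*} (w : ℕ → α) : Set (List α) :=
  {f | ∃ i n : ℕ, f = List.ofFn (fun j : Fin n => w (i + j))}

/-! The following properties of a (finite or infinite) word depend only on its set `F` of factors. -/

/-- `β⁺`-freeness: every factor `r` with a period `1 ≤ p ≤ |r|` has exponent `|r| / p` at most `β`,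
i.e. no factor is a repetition of exponent larger than `β`. -/
def PlusFree {α : Type*} (β : ℚ) (F : Set (List α)) : Prop :=
  ∀ r ∈ F, ∀ p : ℕ, 1 ≤ p → p ≤ r.length → r.HasPeriod p → (r.length : ℚ) / (p : ℚ) ≤ β

/-- Reduced words over `{0, 1, 2, 3}`, where `0, 2` and `1, 3` are pairs of mutual inverses. -/
def ReducedWord (F : Set (List (Fin 4))) : Prop :=
  [0, 2] ∉ F ∧ [2, 0] ∉ F ∧ [1, 3] ∉ F ∧ [3, 1] ∉ F

/-- No factor is a square `uu` with `u` nonempty. -/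
def SquareFreeWord {α : Type*} (F : Set (List α)) : Prop :=
  ∀ u : List α, u ≠ [] → u ++ u ∉ F

/-- A Dean word is a square-free reduced word. -/
def DeanWord (F : Set (List (Fin 4))) : Prop :=
  ReducedWord F ∧ SquareFreeWord F

/-- `d`-directedness: the reverse of a factor of length `d` is never a factor. -/
def DirectedWord {α : Type*} (d : ℕ) (F : Set (List α)) : Prop :=
  ∀ f ∈ F, f.length = d → f.reverse ∉ F

/-- The 72-uniform morphism, given by the images of the letters. -/
def deanMorphism : Fin 4 → List (Fin 4)
  | 0 => [
    0, 1, 0, 3, 2, 1, 0, 1, 2, 3, 0, 3, 2, 1, 0, 3, 0, 1,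
    2, 1, 0, 3, 2, 3, 0, 1, 0, 3, 2, 1, 2, 3, 0, 3, 2, 1,
    0, 3, 0, 1, 2, 3, 2, 1, 0, 3, 2, 3, 0, 1, 2, 1, 0, 3,
    2, 1, 2, 3, 0, 3, 2, 1, 0, 1, 2, 3, 2, 1, 0, 3, 2, 3]
  | 1 => [
    0, 1, 0, 3, 2, 1, 0, 1, 2, 3, 0, 3, 2, 1, 0, 3, 0, 1,
    2, 1, 0, 3, 2, 3, 0, 1, 0, 3, 2, 1, 2, 3, 0, 3, 2, 1,
    0, 1, 2, 3, 2, 1, 0, 3, 2, 3, 0, 1, 2, 1, 0, 3, 2, 1,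
    2, 3, 0, 3, 2, 1, 0, 3, 0, 1, 2, 3, 2, 1, 0, 3, 2, 3]
  | 2 => [
    0, 1, 0, 3, 2, 1, 0, 1, 2, 3, 0, 3, 2, 1, 0, 3, 0, 1,
    2, 1, 0, 3, 2, 3, 0, 1, 0, 3, 2, 1, 0, 1, 2, 3, 2, 1,
    0, 3, 2, 3, 0, 1, 2, 1, 0, 3, 2, 1, 2, 3, 0, 3, 2, 1,
    0, 1, 2, 3, 2, 1, 0, 3, 0, 1, 2, 1, 0, 3, 2, 1, 2, 3]
  | 3 => [
    0, 1, 0, 3, 2, 1, 0, 1, 2, 3, 0, 3, 2, 1, 0, 3, 0, 1,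
    2, 1, 0, 3, 2, 3, 0, 1, 0, 3, 2, 1, 0, 1, 2, 3, 2, 1,
    0, 3, 0, 1, 2, 1, 0, 3, 2, 1, 2, 3, 0, 3, 2, 1, 0, 1,
    2, 3, 2, 1, 0, 3, 2, 3, 0, 1, 2, 1, 0, 3, 2, 1, 2, 3]

theorem deanMorphism_length (a : Fin 4) : (deanMorphism a).length = 72 := by
  fin_cases a <;> rfl

/-- The image `h(w)` of a finite word under the morphism `h`. -/
def finImage (w : List (Fin 4)) : List (Fin 4) := w.flatMap deanMorphism

/-- The image `h(w 0) h(w 1) h(w 2) ⋯` of an infinite word under the 72-uniform morphism `h`: the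
letter at position `72 * q + r`, with `r < 72`, is the letter at position `r` of `h(w q)`. -/
def infImage (w : ℕ → Fin 4) : ℕ → Fin 4 := fun n =>
  (deanMorphism (w (n / 72)))[n % 72]'(by
    rw [deanMorphism_length]; exact Nat.mod_lt n (by norm_num))

/-!
The heart of the matter is how repetitions behave under a uniform morphism `F` whose images contain
a common marker that shows the block boundaries (`Recognizable`). If the repeated part of a
repetition in `F(w)` is long enough to contain a marker, then its period is `n q` for the block
length `n`, and the repetition comes from one in `w` of period `q`. If `m` is the length of the
repeated part in `w`, then the one in the image has length at most `n m + eL + eR`, the constants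
bounding the common suffixes and common prefixes of images of different letters
(`Recognizable.desubstitute`). Repetitions of small period lie in the image of at most four
consecutive letters, and are excluded by a finite computation (`Tight.lt_bound`), which compares a
word with its shifts by bit operations on its two bit planes.

The bound on `w` that fits both uses of this argument is tightness: a repeated part of length
`m > 0` with period `q` satisfies `3 m + 3 ≤ 2 q`. Every `(7/5)⁺`-free word is tight, and the
slack `3` absorbs the constants `eL + eR`. So the 72-uniform morphism maps tight words to
`(5/3)⁺`-free ones (`Tight.deanMorphism_recurs`). Square-freeness is a consequence, while
reducedness and 12-directedness only concern short factors, of which there are finitely many.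

For the existence of an infinite word, an infinite `(7/5)⁺`-free word over four letters is not
needed, only a tight one. The same argument shows that the 34-uniform morphism `coreMorphism` maps
tight words to tight words (`Tight.coreMorphism`). Its fixed point is therefore tight, by induction
on prefixes of length `34 ^ k`, and the 72-uniform morphism is applied to this fixed point.

Finally, a backtracking search shows that there are no 5-directed Dean words of length ten.
-/

/-! ### Repetitions in words given by functions -/

/-- The letters of `w` on `[i, i + ℓ)` recur `p` places to the right; equivalently, the factor
`w[i, i + p + ℓ)` has period `p` and exponent `1 + ℓ / p`. -/
def Recurs {α : Type*} (w : ℕ → α) (i p ℓ : ℕ) : Prop :=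
  ∀ j < ℓ, w (i + j) = w (i + p + j)

/-- The repetition bound that both morphisms can digest: a factor of `w 0 ⋯ w (N - 1)` with period
`p` has length at most `p`, or at most `5p / 3 - 1`. It follows from `(7/5)⁺`-freeness. -/
def Tight {α : Type*} (w : ℕ → α) (N : ℕ) : Prop :=
  ∀ i p ℓ, 0 < p → i + p + ℓ ≤ N → Recurs w i p ℓ → ℓ = 0 ∨ 3 * ℓ + 3 ≤ 2 * p

theorem Tight.ne {α : Type*} {w : ℕ → α} {N i p : ℕ} (h : Tight w N) (hp : 0 < p) (hp' : p ≤ 2)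
    (hi : i + p < N) : w i ≠ w (i + p) := by
  intro he
  have := h i p 1 hp (by omega) (by
    intro j hj
    obtain rfl : j = 0 := by omega
    simpa using he)
  omega

theorem Tight.mono {α : Type*} {w : ℕ → α} {M N : ℕ} (h : Tight w N) (hMN : M ≤ N) : Tight w M :=
  fun i p ℓ hp hi hr => h i p ℓ hp (hi.trans hMN) hr

/-! ### Images under uniform morphisms -/

/-- The image of `w` under the `n`-uniform morphism `F`. -/
def imageWord (F : Fin 4 → List (Fin 4)) (n : ℕ) (w : ℕ → Fin 4) : ℕ → Fin 4 :=
  fun j => (F (w (j / n))).getD (j % n) 0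

/-- `F` is `n`-uniform and recognizable: the factor at position `o` of length `k` is the same in all
images `F a` and occurs in products `F a ++ F b` only at this position modulo `n`. Images of
different letters have a common suffix of length at most `eL` and a common prefix of length at most
`eR`. -/
structure Recognizable (F : Fin 4 → List (Fin 4)) (n o k eL eR : ℕ) : Prop where
  length : ∀ a, (F a).length = n
  fits : o + k ≤ n ∧ 0 < k ∧ eL < n ∧ eR < n
  marker : ∀ a, ∀ t < k, (F a).getD (o + t) 0 = (F 0).getD (o + t) 0
  sync : ∀ a b, ∀ r < n,
    (∀ t < k, (F a ++ F b).getD (r + t) 0 = (F 0).getD (o + t) 0) → r = o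
  final : ∀ a b, (∀ t < eL + 1,
    (F a).getD (n - 1 - eL + t) 0 = (F b).getD (n - 1 - eL + t) 0) → a = b
  initial : ∀ a b, (∀ t < eR + 1, (F a).getD t 0 = (F b).getD t 0) → a = b

theorem imageWord_mul_add (F : Fin 4 → List (Fin 4)) {n : ℕ} (w : ℕ → Fin 4) (B : ℕ) {t : ℕ}
    (ht : t < n) : imageWord F n w (n * B + t) = (F (w B)).getD t 0 := by
  have hn : 0 < n := by omega
  rw [imageWord, Nat.mul_add_div hn, Nat.div_eq_of_lt ht, Nat.mul_add_mod, Nat.mod_eq_of_lt ht,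
    add_zero]

theorem imageWord_mul_add_append {F : Fin 4 → List (Fin 4)} {n : ℕ} (hF : ∀ a, (F a).length = n)
    (w : ℕ → Fin 4) (B : ℕ) {t : ℕ} (ht : t < 2 * n) :
    imageWord F n w (n * B + t) = (F (w B) ++ F (w (B + 1))).getD t 0 := by
  rcases lt_or_ge t n with h | h
  · rw [imageWord_mul_add F w B h, List.getD_append _ _ _ _ (by rw [hF]; exact h)]
  · rw [List.getD_append_right _ _ _ _ (by rw [hF]; exact h), hF,
      ← imageWord_mul_add F w (B + 1) (show t - n < n by omega)]
    congr 1
    rw [mul_add]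
    omega

/-- A long repetition in the image has a period that is a multiple of `n`, since the marker shows
the block boundaries. It comes from a repetition in the preimage: every block of which the repeated
part contains a prefix longer than `eR`, or a suffix longer than `eL`, determines its letter. -/
theorem Recognizable.desubstitute {F : Fin 4 → List (Fin 4)} {n o k eL eR : ℕ}
    (hF : Recognizable F n o k eL eR) {w : ℕ → Fin 4} {N i p ℓ : ℕ} (hi : i + p + ℓ ≤ n * N)
    (hr : Recurs (imageWord F n w) i p ℓ) (hℓ : n + k ≤ ℓ + 1) :
    ∃ q Q m, p = n * q ∧ Q + q + m ≤ N ∧ Recurs w Q q m ∧ ℓ ≤ n * m + eL + eR := by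
  obtain ⟨hok, hk, heL, heR⟩ := hF.fits
  have hn : 0 < n := by omega
  have eq_at : ∀ c, i ≤ c → c < i + ℓ → imageWord F n w c = imageWord F n w (c + p) := by
    intro c h1 h2
    have := hr (c - i) (by omega)
    rwa [show i + (c - i) = c by omega, show i + p + (c - i) = c + p by omega] at this
  -- a complete marker inside the repeated part, in block `B`
  obtain ⟨q, rfl⟩ : n ∣ p := by
    obtain ⟨B, hB1, hB2⟩ : ∃ B, i ≤ n * B + o ∧ n * B + o + k ≤ i + ℓ := by
      refine ⟨(i + n - 1 - o) / n, ?_⟩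
      have h1 := Nat.div_add_mod (i + n - 1 - o) n
      have h2 := Nat.mod_lt (i + n - 1 - o) hn
      generalize n * ((i + n - 1 - o) / n) = x at *
      omega
    have h1 := Nat.div_add_mod (n * B + o + p) n
    have h2 := Nat.mod_lt (n * B + o + p) hn
    have h3 := hF.sync (w ((n * B + o + p) / n)) (w ((n * B + o + p) / n + 1)) _ h2 (by
      intro t ht
      rw [← imageWord_mul_add_append hF.length w _
          (show (n * B + o + p) % n + t < 2 * n by omega), ← hF.marker (w B) t ht,
        ← imageWord_mul_add F w B (show o + t < n by omega), ← add_assoc, ← add_assoc, h1]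
      have := eq_at (n * B + o + t) (by omega) (by omega)
      rw [this]
      congr 1
      omega)
    rw [h3] at h1
    have h4 : n ∣ n * B + p := ⟨(n * B + o + p) / n, by omega⟩
    exact (Nat.dvd_add_right (dvd_mul_right n B)).1 h4
  -- the letters determined by the repeated part are those of the blocks `Q ≤ B < Z`
  obtain ⟨Q, hQ1, hQ2⟩ : ∃ Q, n * Q ≤ i + eL ∧ i + eL < n * Q + n := by
    refine ⟨(i + eL) / n, Nat.mul_div_le _ _, ?_⟩
    have := Nat.lt_mul_div_succ (i + eL) hn
    rwa [mul_add, mul_one] at this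
  obtain ⟨Z, hZ1, hZ2⟩ : ∃ Z, i + ℓ - eR ≤ n * Z ∧ n * Z < i + ℓ - eR + n := by
    refine ⟨(i + ℓ - eR + n - 1) / n, ?_⟩
    have h1 := Nat.div_add_mod (i + ℓ - eR + n - 1) n
    have h2 := Nat.mod_lt (i + ℓ - eR + n - 1) hn
    generalize n * ((i + ℓ - eR + n - 1) / n) = x at *
    omega
  have hmul : ∀ B C, B ≤ C → n * B ≤ n * C := fun B C h => Nat.mul_le_mul_left n h
  rcases le_or_gt Z Q with hZQ | hZQ
  · refine ⟨q, 0, 0, rfl, ?_, fun j hj => absurd hj (by omega), ?_⟩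
    · have : n * q ≤ n * N := by omega
      have := Nat.le_of_mul_le_mul_left this hn
      omega
    · have := hmul _ _ hZQ
      omega
  refine ⟨q, Q, Z - Q, rfl, ?_, ?_, ?_⟩
  · have h1 : n * (Z - 1 + q) < n * N := by
      have : n * (Z - 1 + q) = n * Z - n + n * q := by
        rw [mul_add, Nat.mul_sub, mul_one]
      have := hmul 1 Z (by omega)
      omega
    have := Nat.lt_of_mul_lt_mul_left h1
    omega
  · intro j hj
    have hB1 : n * Q ≤ n * (Q + j) := hmul _ _ (by omega)
    have hB2 : n * (Q + j) + n ≤ n * Z := by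
      have := hmul (Q + j + 1) Z (by omega)
      rwa [mul_add _ (Q + j), mul_one] at this
    rw [show Q + q + j = Q + j + q by omega]
    generalize Q + j = B at *
    have block : ∀ t < n, i ≤ n * B + t → n * B + t < i + ℓ →
        (F (w B)).getD t 0 = (F (w (B + q))).getD t 0 := by
      intro t ht h1 h2
      rw [← imageWord_mul_add F w B ht, ← imageWord_mul_add F w (B + q) ht, eq_at _ h1 h2]
      congr 1
      rw [mul_add]
      omega
    by_cases h : n * B + n ≤ i + ℓ
    · exact hF.final _ _ fun t ht => block _ (by omega) (by omega) (by omega)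
    · exact hF.initial _ _ fun t ht => block _ (by omega) (by omega) (by omega)
  · have : n * (Z - Q) = n * Z - n * Q := Nat.mul_sub _ _ _
    omega

/-! ### Enumeration of words by backtracking -/

/-- The words of length `r` all of whose nonempty suffixes satisfy `good`. -/
def backtrack (good : List (Fin 4) → Bool) : ℕ → List (List (Fin 4))
  | 0 => [[]]
  | r + 1 => (backtrack good r).flatMap fun l =>
      ([0 :: l, 1 :: l, 2 :: l, 3 :: l] : List (List (Fin 4))).filter good

theorem mem_backtrack {good : List (Fin 4) → Bool} {l : List (Fin 4)}
    (h : ∀ s, s <:+ l → s ≠ [] → good s = true) : l ∈ backtrack good l.length := by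
  induction l with
  | nil => simp [backtrack]
  | cons a l ih =>
    rw [List.length_cons, backtrack, List.mem_flatMap]
    refine ⟨l, ih fun s hs => h s (hs.trans (List.suffix_cons a l)), ?_⟩
    rw [List.mem_filter]
    refine ⟨?_, h _ List.suffix_rfl (List.cons_ne_nil _ _)⟩
    fin_cases a
    all_goals simp

/-! ### Short windows of an image -/

theorem getElem?_flatMap_uniform {F : Fin 4 → List (Fin 4)} {n : ℕ} (hF : ∀ a, (F a).length = n)
    (hn : 0 < n) (l : List (Fin 4)) (j : ℕ) :
    (l.flatMap F)[j]? = l[j / n]?.bind fun a => (F a)[j % n]? := by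
  induction l generalizing j with
  | nil => simp
  | cons a l ih =>
    rw [List.flatMap_cons, List.getElem?_append, hF]
    split_ifs with h
    · simp [Nat.div_eq_of_lt h, Nat.mod_eq_of_lt h]
    · obtain ⟨j, rfl⟩ : ∃ j', j = j' + n := ⟨j - n, by omega⟩
      rw [Nat.add_sub_cancel, ih, Nat.add_div_right _ hn, Nat.add_mod_right]
      simp

theorem length_flatMap_uniform {F : Fin 4 → List (Fin 4)} {n : ℕ} (hF : ∀ a, (F a).length = n)
    (l : List (Fin 4)) : (l.flatMap F).length = n * l.length := by
  simp [List.length_flatMap, hF, mul_comm]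

theorem getElem?_flatMap_eq_imageWord {F : Fin 4 → List (Fin 4)} {n : ℕ}
    (hF : ∀ a, (F a).length = n) (hn : 0 < n) {l : List (Fin 4)} {w : ℕ → Fin 4} {B : ℕ}
    (hl : ∀ j < l.length, l[j]? = some (w (B + j))) {j : ℕ} (hj : j < n * l.length) :
    (l.flatMap F)[j]? = some (imageWord F n w (n * B + j)) := by
  have h1 : j / n < l.length := Nat.div_lt_of_lt_mul hj
  have h2 := Nat.mod_lt j hn
  rw [getElem?_flatMap_uniform hF hn, hl _ h1, Option.bind_some, imageWord, Nat.mul_add_div hn,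
    Nat.mul_add_mod, List.getD_eq_getElem?_getD, List.getElem?_eq_getElem (by rw [hF]; exact h2),
    Option.getD_some]

/-- The first letter differs from the next two. -/
def headFresh : List (Fin 4) → Bool
  | [] => true
  | a :: l => decide (a ∉ l.take 2)

/-- Every window of length `s` in the image of a tight word lies in the image of a short factor in
which any three consecutive letters are distinct. -/
theorem Tight.exists_window {F : Fin 4 → List (Fin 4)} {n : ℕ} (hF : ∀ a, (F a).length = n)
    (hn : 0 < n) {w : ℕ → Fin 4} {N : ℕ} (hw : Tight w N) {i s : ℕ} (R : ℕ) (hs : i + s ≤ n * N)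
    (hR : n - 1 + s ≤ n * R) :
    ∃ r ≤ R, ∃ l ∈ backtrack headFresh r, i % n + s ≤ (l.flatMap F).length ∧
      ∀ j < s, (l.flatMap F)[i % n + j]? = some (imageWord F n w (i + j)) := by
  have h1 := Nat.div_add_mod i n
  have h2 := Nat.mod_lt i hn
  set B := i / n
  set l := (List.range (min R (N - B))).map fun t => w (B + t) with hl
  have hlen : l.length = min R (N - B) := by simp [hl]
  have hget : ∀ j < l.length, l[j]? = some (w (B + j)) := by
    intro j hj
    rw [hlen] at hj
    simp [hl, List.getElem?_range hj]
  have hfit : i % n + s ≤ n * l.length := by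
    rw [hlen]
    rcases le_total R (N - B) with h | h
    · rw [min_eq_left h]
      omega
    · rw [min_eq_right h, Nat.mul_sub]
      omega
  refine ⟨l.length, hlen ▸ min_le_left _ _, l, mem_backtrack ?_, ?_, ?_⟩
  · rintro (_ | ⟨a, t⟩) hsuf -
    · rfl
    obtain ⟨u, hu⟩ := hsuf
    have hlu : u.length + t.length + 1 = l.length := by
      rw [← hu]
      simp
      omega
    have e0 : some a = some (w (B + u.length)) := by
      rw [← hget u.length (by omega), ← hu]
      simp
    have ec : ∀ j < t.length, t[j]? = some (w (B + u.length + (j + 1))) := by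
      intro j hj
      rw [add_assoc, ← hget (u.length + (j + 1)) (by omega), ← hu,
        List.getElem?_append_right (by omega), Nat.add_sub_cancel_left, List.getElem?_cons_succ]
    have hBN : l.length ≤ N - B := hlen ▸ min_le_right _ _
    simp only [headFresh, decide_eq_true_eq]
    intro hmem
    obtain ⟨j, hj⟩ := List.mem_iff_getElem?.1 hmem
    rw [List.getElem?_take] at hj
    split_ifs at hj with hj2
    have hjt : j < t.length := (List.getElem?_eq_some_iff.1 hj).1
    rw [ec j hjt, e0] at hj
    exact hw.ne (i := B + u.length) (p := j + 1) (by omega) (by omega) (by omega)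
      (Option.some.inj hj).symm
  · rw [length_flatMap_uniform hF]
    exact hfit
  · intro j hj
    rw [getElem?_flatMap_eq_imageWord hF hn hget (by omega)]
    congr 2
    omega

/-! ### Excluding repetitions in a finite word by bit operations -/

/-- The number whose binary digits are the given bits, the lowest first. -/
def ofBitList : List Bool → ℕ
  | [] => 0
  | b :: l => 2 * ofBitList l + b.toNat

theorem testBit_ofBitList (l : List Bool) (i : ℕ) : (ofBitList l).testBit i = l.getD i false := by
  induction l generalizing i with
  | nil => simp [ofBitList]
  | cons b l ih =>
    cases i with
    | zero => cases b with
      | false => simp [ofBitList]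
      | true => simp [ofBitList]
    | succ i =>
      rw [ofBitList, Nat.testBit_succ, List.getD_cons_succ, ← ih]
      congr 1
      have := b.toNat_lt
      omega

/-- Bit `i` of the result is the disjunction of the bits `i, …, i + ℓ - 1` of `z`. The
number of halvings of `ℓ` is bounded by `fuel`; if this is too small, only some of these bits enter,
and the tests below remain sound. -/
def smear (z : ℕ) : ℕ → ℕ → ℕ
  | 0, _ => z
  | fuel + 1, ℓ => if ℓ ≤ 1 then z else
      let y := smear z fuel ((ℓ + 1) / 2)
      y ||| (y >>> (ℓ / 2))

theorem exists_of_testBit_smear {z fuel ℓ i : ℕ} (hℓ : 0 < ℓ)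
    (h : (smear z fuel ℓ).testBit i = true) : ∃ t < ℓ, z.testBit (i + t) = true := by
  induction fuel generalizing ℓ i with
  | zero => exact ⟨0, hℓ, h⟩
  | succ fuel ih =>
    rw [smear] at h
    split_ifs at h with h1
    · exact ⟨0, hℓ, h⟩
    · simp only [Nat.testBit_or, Nat.testBit_shiftRight, Bool.or_eq_true] at h
      rcases h with h | h
      · obtain ⟨t, ht, h⟩ := ih (by omega) h
        exact ⟨t, by omega, h⟩
      · obtain ⟨t, ht, h⟩ := ih (by omega) h
        refine ⟨ℓ / 2 + t, by omega, ?_⟩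
        rw [← h]
        congr 1
        omega

/-- A test for the word of length `len` with bit planes `e₀` and `e₁` to have no factor of length
`p + ℓ` with period `p`: every `ℓ` consecutive positions include one at which the word differs from
its shift by `p`. -/
def noRecur (e₀ e₁ len p ℓ : ℕ) : Bool :=
  let k := len + 1 - (p + ℓ)
  smear ((e₀ ^^^ (e₀ >>> p)) ||| (e₁ ^^^ (e₁ >>> p))) 8 ℓ % 2 ^ k == 2 ^ k - 1

/-- `noRecur` for all periods `0 < p < P`, where `bound p` is the forbidden length of the repeated
part. -/
def noRecurs (bound : ℕ → ℕ) (P : ℕ) (L : List (Fin 4)) : Bool :=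
  let e₀ := ofBitList (L.map fun a => a.val.testBit 0)
  let e₁ := ofBitList (L.map fun a => a.val.testBit 1)
  let len := L.length
  (List.range P).all fun p => p == 0 || noRecur e₀ e₁ len p (bound p)

theorem not_recurs_of_noRecurs {bound : ℕ → ℕ} {P : ℕ} {L : List (Fin 4)}
    (h : noRecurs bound P L = true) {i p : ℕ} (hp : 0 < p) (hpP : p < P) (hb : 0 < bound p)
    (hi : i + p + bound p ≤ L.length) : ¬ ∀ j < bound p, L[i + j]? = L[i + p + j]? := by
  intro hr
  simp only [noRecurs, List.all_eq_true, List.mem_range, Bool.or_eq_true, beq_iff_eq] at h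
  have h := (h p hpP).resolve_left hp.ne'
  simp only [noRecur, beq_iff_eq] at h
  have hbit := congrArg (fun x => x.testBit i) h
  simp only [Nat.testBit_mod_two_pow, Nat.testBit_two_pow_sub_one] at hbit
  have hik : i < L.length + 1 - (p + bound p) := by omega
  simp only [hik, decide_true, Bool.true_and] at hbit
  obtain ⟨t, ht, hz⟩ := exists_of_testBit_smear hb hbit
  have := hr t ht
  rw [show i + p + t = p + (i + t) by omega] at this
  simp [Nat.testBit_or, Nat.testBit_xor, Nat.testBit_shiftRight, testBit_ofBitList,
    List.getD_eq_getElem?_getD, List.getElem?_map, this] at hz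

/-- Repetitions of period less than `P` in the image of a tight word are excluded by a check of the
images of words of length at most four. -/
theorem Tight.lt_bound {F : Fin 4 → List (Fin 4)} {n : ℕ} (hF : ∀ a, (F a).length = n)
    (hn : 0 < n) {w : ℕ → Fin 4} {N : ℕ} (hw : Tight w N) {bound : ℕ → ℕ} {P : ℕ}
    (hcheck : ∀ r ≤ 4, ∀ l ∈ backtrack headFresh r, noRecurs bound P (l.flatMap F) = true)
    (hbound : ∀ p, 0 < p → p < P → 0 < bound p ∧ n - 1 + (p + bound p) ≤ n * 4)
    {i p ℓ : ℕ} (hp : 0 < p) (hpP : p < P) (hi : i + p + ℓ ≤ n * N)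
    (hr : Recurs (imageWord F n w) i p ℓ) : ℓ < bound p := by
  by_contra! hle
  obtain ⟨hb, hfit⟩ := hbound p hp hpP
  obtain ⟨r, hr4, l, hl, hlen, hget⟩ := hw.exists_window hF hn (i := i) 4
    (show i + (p + bound p) ≤ n * N by omega) hfit
  refine not_recurs_of_noRecurs (hcheck r hr4 l hl) hp hpP hb (i := i % n) (by omega) ?_
  intro j hj
  rw [hget j (by omega), add_assoc (i % n), hget (p + j) (by omega), hr j (by omega), add_assoc]

/-! ### The two morphisms -/

/-- A 34-uniform morphism that preserves tightness. -/
def coreMorphism : Fin 4 → List (Fin 4)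
  | 0 => [
    0, 1, 2, 0, 3, 1, 0, 2, 1, 3, 0, 1, 2, 3, 1, 0, 3,
    2, 0, 1, 3, 0, 2, 3, 1, 2, 0, 1, 3, 2, 1, 0, 2, 3]
  | 1 => [
    0, 1, 2, 0, 3, 1, 0, 2, 1, 3, 2, 0, 1, 2, 3, 1, 0,
    3, 2, 1, 3, 0, 2, 3, 1, 2, 0, 1, 3, 2, 1, 0, 2, 3]
  | 2 => [
    0, 1, 2, 0, 3, 2, 1, 3, 0, 1, 2, 3, 1, 0, 3, 2, 0,
    1, 3, 0, 2, 1, 0, 3, 1, 2, 0, 1, 3, 2, 1, 0, 2, 3]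
  | 3 => [
    0, 1, 2, 0, 3, 2, 1, 3, 0, 2, 3, 1, 0, 3, 2, 0, 1,
    2, 3, 0, 2, 1, 0, 3, 1, 2, 0, 1, 3, 2, 1, 0, 2, 3]

theorem recognizable_coreMorphism : Recognizable coreMorphism 34 2 3 16 10 where
  length a := by fin_cases a <;> rfl
  fits := by omega
  marker := by decide +kernel
  sync := by decide +kernel
  final := by decide +kernel
  initial := by decide +kernel

theorem recognizable_deanMorphism : Recognizable deanMorphism 72 6 5 11 38 where
  length := deanMorphism_length
  fits := by omega
  marker := by decide +kernel
  sync := by decide +kernel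
  final := by decide +kernel
  initial := by decide +kernel

/-- For a period `p > 1`, the least length of a repeated part that violates tightness is
`⌊2 p / 3⌋`; for `p = 1` it is `1`. -/
theorem noRecurs_coreMorphism : ∀ r ≤ 4, ∀ l ∈ backtrack headFresh r,
    noRecurs (fun p => max 1 (2 * p / 3)) 54 (l.flatMap coreMorphism) = true := by
  decide +kernel

/-- For a period `p`, the least length of a repeated part that makes the exponent exceed `5 / 3` is
`⌊2 p / 3⌋ + 1`. -/
theorem noRecurs_deanMorphism : ∀ r ≤ 4, ∀ l ∈ backtrack headFresh r,
    noRecurs (fun p => 2 * p / 3 + 1) 113 (l.flatMap deanMorphism) = true := by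
  decide +kernel

/-! ### A tight infinite word -/

/-- The morphism preserves tightness. For a long period `34 q`, the bounds `3 m + 3 ≤ 2 q` and
`ℓ ≤ 34 m + 26` give `3 ℓ + 3 ≤ 68 q`, since `3 * 26 + 3 ≤ 3 * 34`. -/
theorem Tight.coreMorphism {w : ℕ → Fin 4} {N : ℕ} (hw : Tight w N) :
    Tight (imageWord coreMorphism 34 w) (34 * N) := by
  have hF := recognizable_coreMorphism
  intro i p ℓ hp hi hr
  rcases lt_or_ge p 54 with hpP | hpP
  · have := hw.lt_bound hF.length (by norm_num) noRecurs_coreMorphism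
      (by omega) hp hpP hi hr
    omega
  · by_contra! hcon
    -- if `ℓ` is too short to contain a marker, then it is within the bound because `p` is large
    obtain ⟨q, Q, m, rfl, hN, hm, hle⟩ := hF.desubstitute hi hr (by omega)
    have := hw Q q m (by omega) (by omega) hm
    omega

/-- The fixed point of `coreMorphism` starting with `0`. -/
def coreWord : ℕ → Fin 4
  | 0 => 0
  | j + 1 => (coreMorphism (coreWord ((j + 1) / 34))).getD ((j + 1) % 34) 0
decreasing_by omega

theorem imageWord_coreWord : imageWord coreMorphism 34 coreWord = coreWord := by
  funext j
  rw [imageWord]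
  cases j with
  | zero => simp [coreWord, coreMorphism]
  | succ j => conv_rhs => rw [coreWord]

theorem tight_coreWord (N : ℕ) : Tight coreWord N := by
  have h : ∀ k, Tight coreWord (34 ^ k) := by
    intro k
    induction k with
    | zero => intro i p ℓ hp hi _; omega
    | succ k ih =>
      have := ih.coreMorphism
      rwa [imageWord_coreWord, ← pow_succ'] at this
  exact (h N).mono (Nat.lt_pow_self (by norm_num)).le

/-! ### Images under the 72-uniform morphism -/

/-- The image of a tight word is `(5/3)⁺`-free, in terms of the length `ℓ` of the repeated part. -/
theorem Tight.deanMorphism_recurs {w : ℕ → Fin 4} {N : ℕ} (hw : Tight w N) {i p ℓ : ℕ} (hp : 0 < p)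
    (hi : i + p + ℓ ≤ 72 * N) (hr : Recurs (imageWord deanMorphism 72 w) i p ℓ) :
    3 * ℓ ≤ 2 * p := by
  have hF := recognizable_deanMorphism
  rcases lt_or_ge p 113 with hpP | hpP
  · have := hw.lt_bound hF.length (by norm_num) noRecurs_deanMorphism
      (by omega) hp hpP hi hr
    omega
  · by_contra! hcon
    obtain ⟨q, Q, m, rfl, hN, hm, hle⟩ := hF.desubstitute hi hr (by omega)
    have := hw Q q m (by omega) (by omega) hm
    omega

/-- The factors of length `s` of `L`. -/
def windows (s : ℕ) (L : List (Fin 4)) : List (List (Fin 4)) :=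
  (List.range (L.length + 1 - s)).map fun i => (L.drop i).take s

theorem mem_windows {s : ℕ} {L f : List (Fin 4)} {i : ℕ} (hf : f.length = s)
    (hi : i + s ≤ L.length) (h : ∀ j < s, L[i + j]? = f[j]?) : f ∈ windows s L := by
  rw [windows, List.mem_map]
  refine ⟨i, List.mem_range.2 (by omega), List.ext_getElem? fun j => ?_⟩
  rw [List.getElem?_take, List.getElem?_drop]
  split_ifs with hj
  · exact h j hj
  · exact (List.getElem?_eq_none (by omega)).symm

/-- The factors of length `s ≤ 73` of the images of words of length at most two without
repeated letters. -/
def deanWindows (s : ℕ) : List (List (Fin 4)) :=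
  (List.range 3).flatMap fun r => (backtrack headFresh r).flatMap fun l =>
    windows s (l.flatMap deanMorphism)

/-- The value of a word read in base four. -/
def wordCode (f : List (Fin 4)) : ℕ := f.foldl (fun c a => 4 * c + a.val) 0

/-- The base-four codes of the 88 factors of length 12 that occur in the images. -/
def deanCodes : List ℕ := [
  1282483, 1282489, 1284921, 1653169, 1653171, 1653523, 1784113, 1807129, 1807281,
  3249051, 3249073, 3258683, 3742521, 3742611, 3748243, 3748281, 3780921, 3781521,
  3781523, 3871633, 3871643, 3873081, 4640332, 4646086, 4646124, 5006566, 5006572,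
  5008974, 5129934, 5129956, 5139534, 5139684, 5162212, 5162214, 5162574, 6612676,
  6612686, 6614094, 7097926, 7136366, 7136454, 7228516, 7229124, 7229126, 9548691,
  9550129, 9550139, 9640249, 9640251, 9640851, 9673491, 9673529, 9679161, 9679251,
  10163089, 10172699, 10172721, 11614491, 11614643, 11637659, 11768249, 11768601, 11768603,
  12136851, 12139283, 12139289, 12903532, 12903534, 12904142, 12996204, 12996292, 13034732,
  13518564, 13519972, 13519982, 14970084, 14970444, 14970446, 14992974, 14993124, 15002702,
  15002724, 15123684, 15126086, 15126092, 15486534, 15486572, 15492326]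

theorem wordCode_mem_deanCodes : (deanWindows 12).all (fun f =>
    deanCodes.any (Nat.beq (wordCode f))) = true := by
  decide +kernel

theorem wordCode_reverse_not_mem_deanCodes : (deanWindows 12).all (fun f =>
    !deanCodes.any (Nat.beq (wordCode f.reverse))) = true := by
  decide +kernel

/-- The codes of reversed factors are not codes of factors, so directedness follows without
injectivity of `wordCode`. -/
theorem deanWindows_directed {f : List (Fin 4)} (hf : f ∈ deanWindows 12) :
    f.reverse ∉ deanWindows 12 := by
  intro hr
  have h1 := List.all_eq_true.1 wordCode_mem_deanCodes _ hr
  have h2 := List.all_eq_true.1 wordCode_reverse_not_mem_deanCodes _ hf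
  rw [h1] at h2
  exact absurd h2 (by decide)

theorem deanWindows_reduced : ∀ f ∈ deanWindows 2,
    f ≠ [0, 2] ∧ f ≠ [2, 0] ∧ f ≠ [1, 3] ∧ f ≠ [3, 1] := by
  decide +kernel

/-- The factors of `w 0 ⋯ w (N - 1)`. -/
def prefixFactors {α : Type*} (w : ℕ → α) (N : ℕ) : Set (List α) :=
  {f | ∃ i, i + f.length ≤ N ∧ ∀ j < f.length, f[j]? = some (w (i + j))}

theorem Tight.mem_deanWindows {w : ℕ → Fin 4} {N : ℕ} (hw : Tight w N) {f : List (Fin 4)}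
    (hf : f ∈ prefixFactors (imageWord deanMorphism 72 w) (72 * N)) (hs : f.length ≤ 73) :
    f ∈ deanWindows f.length := by
  obtain ⟨i, hi, hget⟩ := hf
  obtain ⟨r, hr, l, hl, hlen, hgetl⟩ :=
    hw.exists_window deanMorphism_length (by norm_num) 2 hi (by omega)
  simp only [deanWindows, List.mem_flatMap, List.mem_range]
  refine ⟨r, by omega, l, hl, mem_windows rfl hlen fun j hj => ?_⟩
  rw [hgetl j hj, hget j hj]

theorem recurs_of_hasPeriod {α : Type*} {w : ℕ → α} {r : List α} {i p : ℕ} (hp : p ≤ r.length)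
    (hr : ∀ j < r.length, r[j]? = some (w (i + j))) (h : r.HasPeriod p) :
    Recurs w i p (r.length - p) := by
  intro j hj
  have := (List.hasPeriod_iff_getElem?).1 h j hj
  rw [hr j (by omega), hr (j + p) (by omega)] at this
  rw [Option.some.inj this, add_assoc, add_comm p]

theorem hasPeriod_of_recurs {α : Type*} {w : ℕ → α} {r : List α} {i p : ℕ}
    (hr : ∀ j < r.length, r[j]? = some (w (i + j))) (h : Recurs w i p (r.length - p)) :
    r.HasPeriod p := by
  rw [List.hasPeriod_iff_getElem?]
  intro j hj
  rw [hr j (by omega), hr (j + p) (by omega), h j hj, add_assoc, add_comm p]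

theorem PlusFree.squareFreeWord {α : Type*} {β : ℚ} (hβ : β < 2) {S : Set (List α)}
    (h : PlusFree β S) : SquareFreeWord S := by
  intro u hu hmem
  have hpos := List.length_pos_iff.2 hu
  have hle := h _ hmem u.length hpos (by simp) (by
    rw [List.hasPeriod_iff_getElem?]
    intro j hj
    rw [List.length_append, Nat.add_sub_cancel] at hj
    rw [List.getElem?_append_left hj, List.getElem?_append_right (by omega), Nat.add_sub_cancel])
  have hq : (0 : ℚ) < u.length := by exact_mod_cast hpos
  rw [List.length_append, Nat.cast_add, div_le_iff₀ hq] at hle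
  nlinarith

/-- Since the finite list of short factors does not depend on the tight word, the members of `S` may
be factors of the images of different tight words. -/
theorem dean_of_tight {S : Set (List (Fin 4))}
    (h : ∀ f ∈ S, ∃ w N, Tight w N ∧
      f ∈ prefixFactors (imageWord deanMorphism 72 w) (72 * N)) :
    DeanWord S ∧ PlusFree (5 / 3) S ∧ DirectedWord 12 S := by
  have hplus : PlusFree (5 / 3) S := by
    intro r hr p hp hpr hper
    obtain ⟨w, N, hw, i, hi, hget⟩ := h r hr
    have := hw.deanMorphism_recurs (i := i) hp (by omega) (recurs_of_hasPeriod hpr hget hper)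
    have hle : 3 * r.length ≤ 5 * p := by omega
    have hle' : (3 : ℚ) * r.length ≤ 5 * p := by exact_mod_cast hle
    have hq : (0 : ℚ) < p := by exact_mod_cast hp
    rw [div_le_iff₀ hq]
    linarith
  have hwin : ∀ f ∈ S, f.length ≤ 73 → f ∈ deanWindows f.length := by
    intro f hf hs
    obtain ⟨w, N, hw, hf⟩ := h f hf
    exact hw.mem_deanWindows hf hs
  refine ⟨⟨⟨?_, ?_, ?_, ?_⟩, hplus.squareFreeWord (by norm_num)⟩, hplus, ?_⟩
  · exact fun hf => (deanWindows_reduced _ (hwin _ hf (by simp))).1 rfl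
  · exact fun hf => (deanWindows_reduced _ (hwin _ hf (by simp))).2.1 rfl
  · exact fun hf => (deanWindows_reduced _ (hwin _ hf (by simp))).2.2.1 rfl
  · exact fun hf => (deanWindows_reduced _ (hwin _ hf (by simp))).2.2.2 rfl
  · intro f hf hlen hrev
    have h1 := hwin _ hf (by omega)
    have h2 := hwin _ hrev (by simp; omega)
    rw [List.length_reverse, hlen] at h2
    rw [hlen] at h1
    exact deanWindows_directed h1 h2

/-- If `5 m ≤ 2 q` and `m > 0`, then `3 m + 3 ≤ 2 q` as `q` is an integer. -/
theorem tight_of_plusFree {α : Type*} {w : ℕ → α} {N : ℕ}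
    (h : PlusFree (7 / 5) (prefixFactors w N)) : Tight w N := by
  intro i p ℓ hp hi hr
  set r := (List.range (p + ℓ)).map fun j => w (i + j) with hrdef
  have hlen : r.length = p + ℓ := by simp [hrdef]
  have hget : ∀ j < r.length, r[j]? = some (w (i + j)) := by
    intro j hj
    rw [hlen] at hj
    simp [hrdef, List.getElem?_range hj]
  have := h r ⟨i, by omega, hget⟩ p hp (by omega)
    (hasPeriod_of_recurs hget (by rwa [hlen, Nat.add_sub_cancel_left]))
  have hq : (0 : ℚ) < p := by exact_mod_cast hp
  rw [div_le_iff₀ hq, hlen] at this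
  have h5 : (5 : ℚ) * (p + ℓ : ℕ) ≤ 7 * p := by linarith
  have h5' : 5 * (p + ℓ) ≤ 7 * p := by exact_mod_cast h5
  rcases lt_or_ge ℓ 2 with h2 | h2
  · interval_cases ℓ <;> omega
  · omega

theorem PlusFree.mono {α : Type*} {β : ℚ} {S T : Set (List α)} (h : PlusFree β T) (hST : S ⊆ T) :
    PlusFree β S :=
  fun r hr => h r (hST hr)

theorem DeanWord.mono {S T : Set (List (Fin 4))} (h : DeanWord T) (hST : S ⊆ T) : DeanWord S :=
  ⟨⟨fun m => h.1.1 (hST m), fun m => h.1.2.1 (hST m), fun m => h.1.2.2.1 (hST m),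
    fun m => h.1.2.2.2 (hST m)⟩, fun u hu m => h.2 u hu (hST m)⟩

theorem DirectedWord.mono {α : Type*} {d : ℕ} {S T : Set (List α)} (h : DirectedWord d T)
    (hST : S ⊆ T) : DirectedWord d S :=
  fun f hf hd hr => h f (hST hf) hd (hST hr)

theorem prefixFactors_subset_infFactors {α : Type*} (w : ℕ → α) (N : ℕ) :
    prefixFactors w N ⊆ infFactors w := by
  rintro f ⟨i, -, h⟩
  refine ⟨i, f.length, List.ext_getElem? fun j => ?_⟩
  rcases lt_or_ge j f.length with hj | hj
  · rw [h j hj]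
    simp [hj]
  · rw [List.getElem?_eq_none hj, List.getElem?_eq_none (by simpa using hj)]

theorem exists_mem_prefixFactors {α : Type*} {w : ℕ → α} {f : List α} (hf : f ∈ infFactors w) :
    ∃ N₀, ∀ N ≥ N₀, f ∈ prefixFactors w N := by
  obtain ⟨i, n, rfl⟩ := hf
  refine ⟨i + n, fun N hN => ⟨i, by simpa using hN, fun j hj => ?_⟩⟩
  rw [List.length_ofFn] at hj
  simp [hj]

theorem finFactors_eq_prefixFactors {α : Type*} {l : List α} {w : ℕ → α}
    (hw : ∀ j < l.length, l[j]? = some (w j)) : finFactors l = prefixFactors w l.length := by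
  ext f
  constructor
  · rintro ⟨s, t, rfl⟩
    refine ⟨s.length, by simp, fun j hj => ?_⟩
    rw [← hw _ (by simp; omega), List.getElem?_append_left (by simp; omega),
      List.getElem?_append_right (by omega), Nat.add_sub_cancel_left]
  · rintro ⟨i, hi, h⟩
    have : f = (l.drop i).take f.length := by
      refine List.ext_getElem? fun j => ?_
      rw [List.getElem?_take, List.getElem?_drop]
      split_ifs with hj
      · rw [h j hj, hw _ (by omega)]
      · exact List.getElem?_eq_none (by omega)
    show f <:+: l
    rw [this]
    exact ((List.take_prefix _ _).isInfix).trans (List.drop_suffix _ _).isInfix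

theorem infImage_eq_imageWord (w : ℕ → Fin 4) : infImage w = imageWord deanMorphism 72 w := by
  funext j
  rw [infImage, imageWord, List.getD_eq_getElem]

theorem dean_infImage {w : ℕ → Fin 4} (hw : ∀ N, Tight w N) :
    DeanWord (infFactors (infImage w)) ∧ PlusFree (5 / 3) (infFactors (infImage w)) ∧
      DirectedWord 12 (infFactors (infImage w)) := by
  rw [infImage_eq_imageWord]
  refine dean_of_tight fun f hf => ?_
  obtain ⟨N, hN⟩ := exists_mem_prefixFactors hf
  exact ⟨w, N, hw N, hN _ (by omega)⟩

theorem dean_finImage {l : List (Fin 4)} (hl : PlusFree (7 / 5) (finFactors l)) :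
    DeanWord (finFactors (finImage l)) ∧ PlusFree (5 / 3) (finFactors (finImage l)) ∧
      DirectedWord 12 (finFactors (finImage l)) := by
  have hget : ∀ j < l.length, l[j]? = some (l.getD j 0) := by
    intro j hj
    simp [hj]
  rw [finFactors_eq_prefixFactors hget] at hl
  have himage : finFactors (finImage l) =
      prefixFactors (imageWord deanMorphism 72 fun j => l.getD j 0) (72 * l.length) := by
    have hlen : (finImage l).length = 72 * l.length := length_flatMap_uniform deanMorphism_length l
    rw [← hlen]
    refine finFactors_eq_prefixFactors fun j hj => ?_
    rw [hlen] at hj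
    have := getElem?_flatMap_eq_imageWord deanMorphism_length (by norm_num)
      (w := fun j => l.getD j 0) (B := 0) (by simpa using hget) hj
    simpa [finImage] using this
  rw [himage]
  exact dean_of_tight fun f hf => ⟨_, _, tight_of_plusFree hl, hf⟩

/-! ### Directed Dean words with parameter five -/

/-- The conditions of a 5-directed Dean word that involve the beginning of the given word. -/
def deanStep : List (Fin 4) → Bool
  | [] => true
  | a :: l =>
    (l.head? != some (a + 2)) &&
    ((List.range (l.length + 1)).all fun k =>
      k == 0 || decide (l.length + 1 < 2 * k) ||
        ((a :: l).take k != ((a :: l).drop k).take k)) &&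
    (decide (l.length < 4) || !(windows 5 (a :: l)).contains ((a :: l).take 5).reverse)

theorem backtrack_deanStep : backtrack deanStep 10 = [] := by
  decide +kernel

theorem deanStep_of_finFactors_subset {S : Set (List (Fin 4))} (hS : DeanWord S)
    (hd : DirectedWord 5 S) {l : List (Fin 4)} (hl : finFactors l ⊆ S) : deanStep l = true := by
  have hS := hS.mono hl
  have hd := hd.mono hl
  cases l with
  | nil => rfl
  | cons a l =>
    simp only [deanStep, Bool.and_eq_true, Bool.or_eq_true, List.all_eq_true, bne_iff_ne, ne_eq,
      decide_eq_true_eq, beq_iff_eq, Bool.not_eq_true', List.mem_range]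
    refine ⟨⟨?_, ?_⟩, ?_⟩
    · intro h
      obtain ⟨t, rfl⟩ := List.head?_eq_some_iff.1 h
      have hmem : [a, a + 2] ∈ finFactors (a :: (a + 2) :: t) := ⟨[], t, rfl⟩
      obtain ⟨h1, h2, h3, h4⟩ := hS.1
      fin_cases a
      exacts [h1 hmem, h3 hmem, h2 hmem, h4 hmem]
    · intro k hk
      by_contra! hcon
      obtain ⟨⟨hk0, hk1⟩, he⟩ := hcon
      refine hS.2 ((a :: l).take k) ?_ ?_
      · simp
        omega
      · refine ⟨[], ((a :: l).drop k).drop k, ?_⟩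
        conv_lhs => rw [List.nil_append, List.append_assoc]; arg 2; rw [he, List.take_append_drop]
        exact List.take_append_drop _ _
    · by_contra! hcon
      obtain ⟨hlen, hc⟩ := hcon
      rw [ne_eq, Bool.not_eq_false, List.contains_iff_mem, windows, List.mem_map] at hc
      obtain ⟨i, -, hi⟩ := hc
      refine hd ((a :: l).take 5) (List.take_prefix _ _).isInfix (by simp; omega) ?_
      rw [← hi]
      exact ((List.take_prefix _ _).isInfix).trans (List.drop_suffix _ _).isInfix

theorem length_lt_of_deanWord_of_directedWord {l : List (Fin 4)} (hS : DeanWord (finFactors l))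
    (hd : DirectedWord 5 (finFactors l)) : l.length < 10 := by
  by_contra! hlen
  have hmem : l.take 10 ∈ backtrack deanStep (l.take 10).length :=
    mem_backtrack fun s hs _ => deanStep_of_finFactors_subset hS hd fun f hf =>
      hf.trans (hs.isInfix.trans (List.take_prefix _ _).isInfix)
  rw [List.length_take, min_eq_left hlen, backtrack_deanStep] at hmem
  exact absurd hmem List.not_mem_nil

theorem not_directedWord_of_deanWord {w : ℕ → Fin 4} (hS : DeanWord (infFactors w)) :
    ¬ DirectedWord 5 (infFactors w) := by
  intro hd
  have hsub : finFactors ((List.range 10).map w) ⊆ infFactors w := by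
    rw [finFactors_eq_prefixFactors (w := w) (by
      intro j hj
      rw [List.length_map, List.length_range] at hj
      simp only [List.getElem?_map, List.getElem?_range hj, Option.map_some])]
    exact prefixFactors_subset_infFactors _ _
  have := length_lt_of_deanWord_of_directedWord (hS.mono hsub) (hd.mono hsub)
  simp at this

theorem mainTheorem11 :
    -- an infinite Dean word with the required properties exists
    (∃ w : ℕ → Fin 4, DeanWord (infFactors w) ∧ PlusFree (5 / 3) (infFactors w) ∧
      DirectedWord 12 (infFactors w)) ∧
    -- images of infinite and of finite `(7/5)⁺`-free words over four letters
    (∀ w : ℕ → Fin 4, PlusFree (7 / 5) (infFactors w) →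
      DeanWord (infFactors (infImage w)) ∧ PlusFree (5 / 3) (infFactors (infImage w)) ∧
        DirectedWord 12 (infFactors (infImage w))) ∧
    (∀ w : List (Fin 4), PlusFree (7 / 5) (finFactors w) →
      DeanWord (finFactors (finImage w)) ∧ PlusFree (5 / 3) (finFactors (finImage w)) ∧
        DirectedWord 12 (finFactors (finImage w))) ∧
    -- 5-directed Dean words, finite or infinite, have length below 10
    (∀ w : List (Fin 4), DeanWord (finFactors w) → DirectedWord 5 (finFactors w) →
      w.length < 10) ∧
    (∀ w : ℕ → Fin 4, DeanWord (infFactors w) → ¬ DirectedWord 5 (infFactors w)) := by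
  refine ⟨⟨_, dean_infImage tight_coreWord⟩, fun w hw => dean_infImage fun N => ?_,
    fun w => dean_finImage, fun w => length_lt_of_deanWord_of_directedWord,
    fun w => not_directedWord_of_deanWord⟩
  exact tight_of_plusFree (hw.mono (prefixFactors_subset_infFactors w N))
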